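/- Let $A\in\mathbb C^{n\times n}$ be stable (all eigenvalues in the open unit disc), let $C\in\mathbb C^{m\times n}$, $\Gamma\in\mathbb C^{n\times m}$, $R_0\in\mathbb C^{m\times m}$, and put $$R(z)=zC(I_n-zA)^{-1}\Gamma+R_0+\Gamma^*(zI_n-A^*)^{-1}C^*.$$ Assume that $R(\zeta)$ is a nonnegative (positive semidefinite) matrix for each $|\zeta|=1$. Write $\mathfrak RH^\infty_{k\times l}$ for the rational $k\times l$ matrix functions without poles in the closed unit disc. For $\Omega\in\mathfrak RH^\infty_{k\times l}$ with Taylor coefficients $\Omega_0,\Omega_1,\dots$ at $0$, let $T_\Omega:\ell^2_+(\mathbb C^l)\to\ell^2_+(\mathbb C^k)$, $(T_\Omega f)_i=\sum_{j\le i}\Omega_{i-j}f_j$, be the block Toeplitz operator. For a $k\times n$ matrix $G$, the observability operator of the pair $\{G,A\}$ is the map $x\mapsto (GA^\nu x)_{\nu\ge0}$ from $\mathbb C^n$ into $\ell^2_+(\mathbb C^k)$, and its observability Gramian is $\sum_{\nu\ge0}(A^\nu)^*G^*GA^\nu$; the pair is observable if the observability operator is injective. Let $W_{obs}$ be the observability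 operator of $\{C,A\}$. Let $\Phi\in\mathfrak RH^\infty_{r\times m}$ be an outer spectral factor of $R$, that is, $R(\zeta)=\Phi(\zeta)^*\Phi(\zeta)$ for $|\zeta|=1$ and $T_\Phi$ has dense range. Put $$\mathcal X_\Phi=\{x\in\mathbb C^n : W_{obs}x\in\operatorname{Im}T_\Phi^*\},\qquad \mathcal M_\Phi=\{f\in\ell^2_+(\mathbb C^r) : T_\Phi^*f\in\operatorname{Im}W_{obs}\},$$ and let $E_{\mathcal X_\Phi}:\mathcal X_\Phi\to\mathbb C^n$ be the embedding. Let $C_\Phi$ be an $r\times n$ matrix such that $W_{obs}x=T_\Phi^*W_{\Phi,obs}x$ for all $x\in\mathcal X_\Phi$, where $W_{\Phi,obs}$ is the observability operator of $\{C_\Phi,A\}$, and let $Q_\Phi$ be the observability Gramian of $\{C_\Phi,A\}$. **Proposition.** Assume that the pair $\{C,A\}$ is observable. Let $\Theta\in\mathfrak RH^\infty_{r\times r}$ be a two-sided inner function (its values on the unit circle are unitary) with $\operatorname{Ker}T_\Theta^*=\mathcal M_\Phi$. Then there exist matrices $B_\Theta\in\mathbb C^{n\times r}$ and $D_\Theta\in\mathbb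 C^{r\times r}$ such that $$\Theta(z)=D_\Theta+zC_\Phi(I_n-zA)^{-1}B_\Theta$$ (for all $z\in\mathbb C$ for which $I_n-zA$ is invertible), $$(B_\Theta^*Q_\Phi A+D_\Theta^*C_\Phi)E_{\mathcal X_\Phi}=0\quad\text{and}\quad B_\Theta^*Q_\Phi B_\Theta+D_\Theta^*D_\Theta=I_r.$$ -/

import Mathlib

open scoped Matrix ComplexOrder

/-- The Hilbert space `ℓ²₊(ℂᵏ)` of square summable one-sided sequences of vectors in `ℂᵏ`. -/
abbrev EllTwo (k : ℕ) : Type := lp (fun _ : ℕ => EuclideanSpace ℂ (Fin k)) 2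

/-- A square matrix is stable if all its eigenvalues lie in the open unit disc. -/
def IsStableMatrix {n : ℕ} (A : Matrix (Fin n) (Fin n) ℂ) : Prop :=
  ∀ μ ∈ spectrum ℂ A, ‖μ‖ < 1

/-! ### Rational matrix functions -/

/-- The value `Ω(z)` of a rational matrix function at a point `z` that is not a pole. -/
noncomputable def ratEval {k l : ℕ} (Ω : Matrix (Fin k) (Fin l) (RatFunc ℂ)) (z : ℂ) :
    Matrix (Fin k) (Fin l) ℂ :=
  Matrix.of fun i j => (Ω i j).eval (RingHom.id ℂ) z

/-- `Ω ∈ ℜH^∞`: the rational matrix function `Ω` has no poles in the closed unit disc. -/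
def IsStableRational {k l : ℕ} (Ω : Matrix (Fin k) (Fin l) (RatFunc ℂ)) : Prop :=
  ∀ i j, ∀ z : ℂ, ‖z‖ ≤ 1 → (Ω i j).denom.eval z ≠ 0

/-- The `ν`-th Taylor coefficient at `0`; for `Ω ∈ ℜH^∞` this is the `ν`-th Fourier coefficient
of `Ω` on the unit circle, the Fourier coefficients with negative index being zero. -/
noncomputable def taylorCoeff {k l : ℕ} (Ω : Matrix (Fin k) (Fin l) (RatFunc ℂ)) (ν : ℕ) :
    Matrix (Fin k) (Fin l) ℂ :=
  Matrix.of fun i j =>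
    iteratedDeriv ν (fun z : ℂ => (Ω i j).eval (RingHom.id ℂ) z) 0 / (ν.factorial : ℂ)

/-! ### Helper facts: existence of the operators -/

theorem exists_shiftMul {k l : ℕ}
    (L : EuclideanSpace ℂ (Fin l) →L[ℂ] EuclideanSpace ℂ (Fin k)) (ν : ℕ) :
    ∃ T : EllTwo l →L[ℂ] EllTwo k, ‖T‖ ≤ ‖L‖ ∧
      ∀ f i, (T f : ℕ → EuclideanSpace ℂ (Fin k)) i =
        if ν ≤ i then L ((f : ℕ → EuclideanSpace ℂ (Fin l)) (i - ν)) else 0 := by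
  have h2 : 0 < (2 : ENNReal).toReal := by norm_num
  have key : ∀ f : EllTwo l, ∀ s : Finset ℕ,
      ∑ i ∈ s, ‖(if ν ≤ i then L ((f : ℕ → EuclideanSpace ℂ (Fin l)) (i - ν)) else 0)‖
        ^ (2 : ENNReal).toReal ≤ (‖L‖ * ‖f‖) ^ (2 : ENNReal).toReal := by
    intro f s
    have hs : Summable fun i : ℕ => ‖(f : ℕ → EuclideanSpace ℂ (Fin l)) i‖
        ^ (2 : ENNReal).toReal := (lp.hasSum_norm h2 f).summable
    calc ∑ i ∈ s, ‖(if ν ≤ i then L ((f : ℕ → EuclideanSpace ℂ (Fin l)) (i - ν)) else 0)‖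
        ^ (2 : ENNReal).toReal
        = ∑ i ∈ s with ν ≤ i, ‖L ((f : ℕ → EuclideanSpace ℂ (Fin l)) (i - ν))‖
        ^ (2 : ENNReal).toReal := by
          rw [Finset.sum_filter]
          refine Finset.sum_congr rfl fun i _ => ?_
          split_ifs <;> simp
      _ ≤ ∑ i ∈ s with ν ≤ i, ‖L‖ ^ (2 : ENNReal).toReal *
            ‖(f : ℕ → EuclideanSpace ℂ (Fin l)) (i - ν)‖ ^ (2 : ENNReal).toReal := by
          refine Finset.sum_le_sum fun i _ => ?_
          rw [← Real.mul_rpow (norm_nonneg _) (norm_nonneg _)]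
          exact Real.rpow_le_rpow (norm_nonneg _) (L.le_opNorm _) h2.le
      _ = ‖L‖ ^ (2 : ENNReal).toReal * ∑ j ∈ (s.filter (ν ≤ ·)).image (· - ν),
            ‖(f : ℕ → EuclideanSpace ℂ (Fin l)) j‖ ^ (2 : ENNReal).toReal := by
          rw [Finset.sum_image, Finset.mul_sum]
          intro a ha b hb hab
          simp only [Finset.coe_filter, Set.mem_ofPred_eq] at ha hb hab
          omega
      _ ≤ ‖L‖ ^ (2 : ENNReal).toReal * ‖f‖ ^ (2 : ENNReal).toReal := by
          refine mul_le_mul_of_nonneg_left ?_ (Real.rpow_nonneg (norm_nonneg _) _)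
          rw [lp.norm_rpow_eq_tsum h2]
          exact hs.sum_le_tsum _ fun i _ => Real.rpow_nonneg (norm_nonneg _) _
      _ = (‖L‖ * ‖f‖) ^ (2 : ENNReal).toReal :=
          (Real.mul_rpow (norm_nonneg _) (norm_nonneg _)).symm
  let T₀ : EllTwo l →ₗ[ℂ] EllTwo k :=
    { toFun := fun f => ⟨fun i => if ν ≤ i then
          L ((f : ℕ → EuclideanSpace ℂ (Fin l)) (i - ν)) else 0, memℓp_gen' (key f)⟩
      map_add' := by
        intro f g
        ext1
        funext i
        simp only [lp.coeFn_add, Pi.add_apply]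
        split_ifs <;> simp
      map_smul' := by
        intro c f
        ext1
        funext i
        simp only [lp.coeFn_smul, Pi.smul_apply, RingHom.id_apply]
        split_ifs <;> simp }
  have hT : ∀ f, ‖T₀ f‖ ≤ ‖L‖ * ‖f‖ := fun f =>
    lp.norm_le_of_forall_sum_le h2 (by positivity) (key f)
  exact ⟨T₀.mkContinuous ‖L‖ hT, T₀.mkContinuous_norm_le (norm_nonneg _) hT, fun f i => rfl⟩

theorem summable_norm_taylorCoeff {k l : ℕ} {Ω : Matrix (Fin k) (Fin l) (RatFunc ℂ)}
    (hΩ : IsStableRational Ω) (i : Fin k) (j : Fin l) :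
    Summable fun ν => ‖taylorCoeff Ω ν i j‖ := by
  set f : ℂ → ℂ := fun z => (Ω i j).eval (RingHom.id ℂ) z with hf
  have hopen : IsOpen {z : ℂ | (Ω i j).denom.eval z ≠ 0} :=
    isOpen_ne_fun (Ω i j).denom.continuous continuous_const
  have hsub : Metric.closedBall (0 : ℂ) 1 ⊆ {z : ℂ | (Ω i j).denom.eval z ≠ 0} := by
    intro z hz
    exact hΩ i j z (by simpa using hz)
  obtain ⟨δ, hδ, hδs⟩ := (isCompact_closedBall (0 : ℂ) 1).exists_cthickening_subset_open hopen hsub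
  rw [cthickening_closedBall hδ.le zero_le_one] at hδs
  have hdiff : DifferentiableOn ℂ f (Metric.closedBall 0 (δ + 1)) := by
    intro z hz
    have : DifferentiableAt ℂ
        (fun z : ℂ => (Ω i j).num.eval z / (Ω i j).denom.eval z) z :=
      (Ω i j).num.differentiableAt.div (Ω i j).denom.differentiableAt (hδs hz)
    exact this.differentiableWithinAt
  obtain ⟨M, hM⟩ := (isCompact_closedBall (0 : ℂ) (δ + 1)).exists_bound_of_continuousOn
    hdiff.continuousOn
  have hM0 : 0 ≤ M := (norm_nonneg _).trans (hM 0 (by simp; linarith))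
  have hbound : ∀ ν, ‖taylorCoeff Ω ν i j‖ ≤ M * (1 / (δ + 1)) ^ ν := by
    intro ν
    have h := Complex.norm_iteratedDeriv_le_of_forall_mem_sphere_norm_le (c := (0 : ℂ)) (f := f) ν
      (show 0 < δ + 1 by linarith) (hdiff.diffContOnCl_ball subset_rfl)
      (fun z hz => hM z (Metric.sphere_subset_closedBall hz))
    have hpos : (0 : ℝ) < (ν.factorial : ℝ) := by positivity
    simp only [taylorCoeff, Matrix.of_apply, norm_div, Complex.norm_natCast]
    rw [div_le_iff₀ hpos]
    calc _ ≤ _ := h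
      _ = _ := by rw [one_div, inv_pow]; ring
  refine Summable.of_nonneg_of_le (fun _ => norm_nonneg _) hbound ?_
  refine (summable_geometric_of_lt_one (by positivity) ?_).mul_left M
  rw [div_lt_one (by linarith)]
  linarith

/-- For `Ω ∈ ℜH^∞`, the lower triangular block matrix `(Ω_{i-j})` is a bounded operator. -/
theorem exists_toeplitz {k l : ℕ} {Ω : Matrix (Fin k) (Fin l) (RatFunc ℂ)}
    (hΩ : IsStableRational Ω) :
    ∃ T : EllTwo l →L[ℂ] EllTwo k, ∀ f i,
      (T f : ℕ → EuclideanSpace ℂ (Fin k)) i = ∑ j ∈ Finset.range (i + 1),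
        Matrix.toEuclideanLin (taylorCoeff Ω (i - j))
          ((f : ℕ → EuclideanSpace ℂ (Fin l)) j) := by
  let J : Matrix (Fin k) (Fin l) ℂ →ₗ[ℂ]
      (EuclideanSpace ℂ (Fin l) →L[ℂ] EuclideanSpace ℂ (Fin k)) :=
    LinearMap.toContinuousLinearMap.toLinearMap ∘ₗ Matrix.toEuclideanLin.toLinearMap
  have hJ : Summable fun ν => ‖J (taylorCoeff Ω ν)‖ := by
    have hs : Summable fun ν => ∑ i, ∑ j,
        ‖taylorCoeff Ω ν i j‖ * ‖J (Matrix.single i j 1)‖ :=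
      summable_sum fun i _ => summable_sum fun j _ =>
        (summable_norm_taylorCoeff hΩ i j).mul_right _
    refine Summable.of_nonneg_of_le (fun _ => norm_nonneg _) (fun ν => ?_) hs
    conv_lhs => rw [Matrix.matrix_eq_sum_single (taylorCoeff Ω ν)]
    rw [map_sum]
    refine (norm_sum_le _ _).trans (Finset.sum_le_sum fun i _ => ?_)
    rw [map_sum]
    refine (norm_sum_le _ _).trans (Finset.sum_le_sum fun j _ => ?_)
    have : Matrix.single i j (taylorCoeff Ω ν i j)
        = taylorCoeff Ω ν i j • Matrix.single i j (1 : ℂ) := by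
      rw [Matrix.smul_single, smul_eq_mul, mul_one]
    rw [this, map_smul, norm_smul]
  choose S hS hS' using fun ν => exists_shiftMul (J (taylorCoeff Ω ν)) ν
  have hsum : Summable S := Summable.of_norm_bounded hJ hS
  refine ⟨∑' ν, S ν, fun f i => ?_⟩
  have h1 : HasSum (fun ν => (S ν f : ℕ → EuclideanSpace ℂ (Fin k)) i)
      (((∑' ν, S ν) f : EllTwo k) i) := by
    have := (hsum.hasSum.mapL (ContinuousLinearMap.apply ℂ (EllTwo k) f)).mapL
      (lp.evalCLM ℂ (fun _ : ℕ => EuclideanSpace ℂ (Fin k)) 2 i)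
    exact this
  have h2 : HasSum (fun ν => (S ν f : ℕ → EuclideanSpace ℂ (Fin k)) i)
      (∑ ν ∈ Finset.range (i + 1), (S ν f : ℕ → EuclideanSpace ℂ (Fin k)) i) :=
    hasSum_sum_of_ne_finset_zero fun ν hν => by
      rw [hS', if_neg]
      simpa [Nat.lt_succ_iff] using hν
  rw [h1.unique h2, ← Finset.sum_range_reflect]
  refine Finset.sum_congr rfl fun j hj => ?_
  have hj' : j ≤ i := by simpa [Nat.lt_succ_iff] using hj
  rw [hS', if_pos (by omega)]
  have e1 : i + 1 - 1 - j = i - j := by omega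
  have e2 : i - (i - j) = j := by omega
  rw [e1, e2]
  rfl

theorem summable_norm_pow_mulVec {n k : ℕ} {A : Matrix (Fin n) (Fin n) ℂ}
    (hA : IsStableMatrix A) (C : Matrix (Fin k) (Fin n) ℂ) (x : EuclideanSpace ℂ (Fin n)) :
    Summable fun ν : ℕ => ‖Matrix.toEuclideanLin (C * A ^ ν) x‖ := by
  rcases Nat.eq_zero_or_pos n with hn | hn
  · subst hn
    have : x = 0 := Subsingleton.elim _ _
    simp [this]
  have : Nonempty (Fin n) := ⟨⟨0, hn⟩⟩
  let e := Matrix.toEuclideanCLM (n := Fin n) (𝕜 := ℂ)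
  set a := e A with ha
  have : Nontrivial (EuclideanSpace ℂ (Fin n) →L[ℂ] EuclideanSpace ℂ (Fin n)) := inferInstance
  have hspec : spectrum ℂ a = spectrum ℂ A := AlgEquiv.spectrum_eq e A
  have hlt : spectralRadius ℂ a < ((1 : NNReal) : ENNReal) := by
    refine spectrum.spectralRadius_lt_of_forall_lt a fun z hz => ?_
    rw [hspec] at hz
    exact_mod_cast hA z hz
  obtain ⟨q, hq1, hq2⟩ := ENNReal.lt_iff_exists_nnreal_btwn.1 hlt
  have hev := (spectrum.pow_nnnorm_pow_one_div_tendsto_nhds_spectralRadius a).eventually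
    (gt_mem_nhds hq1)
  have hq : (q : ℝ) < 1 := by exact_mod_cast hq2
  have hpow : ∀ᶠ ν : ℕ in Filter.atTop, ‖a ^ ν‖ ≤ (q : ℝ) ^ ν := by
    filter_upwards [hev, Filter.eventually_gt_atTop 0] with ν hν hν0
    have h := ENNReal.rpow_le_rpow hν.le (Nat.cast_nonneg (α := ℝ) ν)
    rw [← ENNReal.rpow_mul, one_div_mul_cancel (by positivity), ENNReal.rpow_one,
      ENNReal.rpow_natCast] at h
    exact_mod_cast h
  have hsa : Summable fun ν : ℕ => ‖a ^ ν‖ := by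
    refine Summable.of_norm_bounded_eventually_nat (g := fun ν => (q : ℝ) ^ ν)
      (summable_geometric_of_lt_one q.2 hq) ?_
    simpa using hpow
  let L := LinearMap.toContinuousLinearMap (Matrix.toEuclideanLin C)
  refine Summable.of_nonneg_of_le (fun _ => norm_nonneg _) (fun ν => ?_)
    ((hsa.mul_left ‖L‖).mul_right ‖x‖)
  have : Matrix.toEuclideanLin (C * A ^ ν) x = L ((a ^ ν) x) := by
    rw [ha, ← map_pow]
    change Matrix.toEuclideanLin (C * A ^ ν) x =
      Matrix.toEuclideanLin C (Matrix.toEuclideanLin (A ^ ν) x)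
    simp only [Matrix.toLpLin_apply, Matrix.mulVec_mulVec]
  rw [this, mul_assoc]
  exact (L.le_opNorm _).trans (mul_le_mul_of_nonneg_left ((a ^ ν).le_opNorm x) (norm_nonneg _))

theorem memℓp_obs {n k : ℕ} {A : Matrix (Fin n) (Fin n) ℂ}
    (hA : IsStableMatrix A) (C : Matrix (Fin k) (Fin n) ℂ) (x : EuclideanSpace ℂ (Fin n)) :
    Memℓp (fun ν : ℕ => Matrix.toEuclideanLin (C * A ^ ν) x) 2 := by
  have h1 : Memℓp (fun ν : ℕ => Matrix.toEuclideanLin (C * A ^ ν) x) 1 :=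
    memℓp_gen (by simpa using summable_norm_pow_mulVec hA C x)
  exact h1.of_exponent_ge (by norm_num)

/-! ### Toeplitz and observability operators -/

/-- The block Toeplitz operator `T_Ω : ℓ²₊(ℂˡ) → ℓ²₊(ℂᵏ)` of `Ω ∈ ℜH^∞`: the bounded operator with
`(T_Ω f)_i = ∑_{j ≤ i} Ω_{i-j} f_j`. -/
noncomputable def toeplitz {k l : ℕ} (Ω : Matrix (Fin k) (Fin l) (RatFunc ℂ))
    (hΩ : IsStableRational Ω) : EllTwo l →L[ℂ] EllTwo k :=
  (exists_toeplitz hΩ).choose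

theorem toeplitz_apply {k l : ℕ} (Ω : Matrix (Fin k) (Fin l) (RatFunc ℂ))
    (hΩ : IsStableRational Ω) (f : EllTwo l) (i : ℕ) :
    (toeplitz Ω hΩ f : ℕ → EuclideanSpace ℂ (Fin k)) i = ∑ j ∈ Finset.range (i + 1),
      Matrix.toEuclideanLin (taylorCoeff Ω (i - j))
        ((f : ℕ → EuclideanSpace ℂ (Fin l)) j) :=
  (exists_toeplitz hΩ).choose_spec f i

/-- The observability operator `x ↦ (Cx, CAx, CA²x, …)` from `ℂⁿ` to `ℓ²₊(ℂᵏ)` of the pair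
`{C, A}`, where `A` is stable. -/
noncomputable def obsOp {n k : ℕ} (C : Matrix (Fin k) (Fin n) ℂ) (A : Matrix (Fin n) (Fin n) ℂ)
    (hA : IsStableMatrix A) : EuclideanSpace ℂ (Fin n) →ₗ[ℂ] EllTwo k where
  toFun x := ⟨fun ν => Matrix.toEuclideanLin (C * A ^ ν) x, memℓp_obs hA C x⟩
  map_add' x y := by
    ext1
    funext ν
    exact map_add _ x y
  map_smul' c x := by
    ext1
    funext ν
    exact map_smul _ c x

/-- The pair `{C, A}` is observable: `Ker W_obs = {0}`. -/
def IsObservable {n k : ℕ} (C : Matrix (Fin k) (Fin n) ℂ) (A : Matrix (Fin n) (Fin n) ℂ)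
    (hA : IsStableMatrix A) : Prop :=
  LinearMap.ker (obsOp C A hA) = ⊥

/-- The observability Gramian `∑ (A^ν)^* C^* C A^ν` of the pair `{C, A}`, where `A` is stable
(the series converges then). -/
noncomputable def obsGramian {n k : ℕ} (C : Matrix (Fin k) (Fin n) ℂ)
    (A : Matrix (Fin n) (Fin n) ℂ) : Matrix (Fin n) (Fin n) ℂ :=
  ∑' ν : ℕ, (A ^ ν)ᴴ * Cᴴ * C * A ^ ν

/-- The series defining the Gramian converges, and its sum is the matrix of `W_obs^* W_obs`. -/
theorem hasSum_obsGramian {n k : ℕ} (C : Matrix (Fin k) (Fin n) ℂ)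
    (A : Matrix (Fin n) (Fin n) ℂ) (hA : IsStableMatrix A) :
    HasSum (fun ν : ℕ => (A ^ ν)ᴴ * Cᴴ * C * A ^ ν) (Matrix.of fun i j =>
      inner ℂ (obsOp C A hA (EuclideanSpace.single i 1))
        (obsOp C A hA (EuclideanSpace.single j 1))) := by
  refine Pi.hasSum.2 fun i => Pi.hasSum.2 fun j => ?_
  refine (lp.hasSum_inner (𝕜 := ℂ) (obsOp C A hA (EuclideanSpace.single i 1))
    (obsOp C A hA (EuclideanSpace.single j 1))).congr_fun ?_
  intro ν
  have h : (A ^ ν)ᴴ * Cᴴ * C * A ^ ν = (C * A ^ ν)ᴴ * (C * A ^ ν) := by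
    rw [Matrix.conjTranspose_mul, Matrix.mul_assoc _ C]
  change ((A ^ ν)ᴴ * Cᴴ * C * A ^ ν) i j =
    inner ℂ (Matrix.toEuclideanLin (C * A ^ ν) (EuclideanSpace.single i 1))
      (Matrix.toEuclideanLin (C * A ^ ν) (EuclideanSpace.single j 1))
  rw [h]
  generalize C * A ^ ν = M
  rw [Matrix.mul_apply, PiLp.inner_apply]
  simp [Matrix.toLpLin_apply, mul_comm]

/-! ### Spectral factors and inner functions -/

/-- `R(z) = zC(I - zA)⁻¹Γ + R₀ + Γ^*(zI - A^*)⁻¹C^*`. -/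
noncomputable def weightR {m n : ℕ} (A : Matrix (Fin n) (Fin n) ℂ) (C : Matrix (Fin m) (Fin n) ℂ)
    (Γ : Matrix (Fin n) (Fin m) ℂ) (R₀ : Matrix (Fin m) (Fin m) ℂ) (z : ℂ) :
    Matrix (Fin m) (Fin m) ℂ :=
  z • (C * (1 - z • A)⁻¹ * Γ) + R₀ + Γᴴ * (z • (1 : Matrix (Fin n) (Fin n) ℂ) - Aᴴ)⁻¹ * Cᴴ

/-- `Φ ∈ ℜH^∞` is an outer spectral factor of `R`: `R = Φ^*Φ` (on the unit circle, where
`Φ^*(ζ) = Φ(ζ)^*`), and `T_Φ` has dense range. -/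
def IsOuterSpectralFactor {m r : ℕ} (R : ℂ → Matrix (Fin m) (Fin m) ℂ)
    (Φ : Matrix (Fin r) (Fin m) (RatFunc ℂ)) (hΦ : IsStableRational Φ) : Prop :=
  (∀ ζ : ℂ, ‖ζ‖ = 1 → R ζ = (ratEval Φ ζ)ᴴ * ratEval Φ ζ) ∧ DenseRange (toeplitz Φ hΦ)

/-- `Θ ∈ ℜH^∞` is two-sided inner: its values on the unit circle are unitary matrices. -/
def IsTwoSidedInner {r : ℕ} (Θ : Matrix (Fin r) (Fin r) (RatFunc ℂ)) : Prop :=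
  ∀ ζ : ℂ, ‖ζ‖ = 1 → ratEval Θ ζ ∈ Matrix.unitaryGroup (Fin r) ℂ

/-- `𝒳_Φ = {x ∈ ℂⁿ | W_obs x ∈ Im T_Φ^*}`. -/
noncomputable def spaceX {m n r : ℕ} (C : Matrix (Fin m) (Fin n) ℂ)
    (A : Matrix (Fin n) (Fin n) ℂ) (hA : IsStableMatrix A)
    (Φ : Matrix (Fin r) (Fin m) (RatFunc ℂ)) (hΦ : IsStableRational Φ) :
    Submodule ℂ (EuclideanSpace ℂ (Fin n)) :=
  (LinearMap.range (ContinuousLinearMap.adjoint (toeplitz Φ hΦ)).toLinearMap).comap (obsOp C A hA)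

/-- `ℳ_Φ = {f ∈ ℓ²₊(ℂʳ) | T_Φ^* f ∈ Im W_obs}`. -/
noncomputable def spaceM {m n r : ℕ} (C : Matrix (Fin m) (Fin n) ℂ)
    (A : Matrix (Fin n) (Fin n) ℂ) (hA : IsStableMatrix A)
    (Φ : Matrix (Fin r) (Fin m) (RatFunc ℂ)) (hΦ : IsStableRational Φ) :
    Submodule ℂ (EllTwo r) :=
  (LinearMap.range (obsOp C A hA)).comap
    (ContinuousLinearMap.adjoint (toeplitz Φ hΦ)).toLinearMap

/-!
Let `Θ_ν` be the coefficient of `z^ν` in `Θ(z)`. Comparing coefficients, `D_Θ` has to be `Θ_0`,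
and `B_Θ` has to satisfy `Θ_{ν+1} = C_Φ A^ν B_Θ`. Such a `B_Θ` exists once each column of
`(Θ(z) - Θ_0) / z`, regarded as an element of `ℓ²₊`, lies in the image of `W_{Φ,obs}`.

That it does rests on two facts. Since `Θ` is inner, `T_Θ` is an isometry commuting with the shift
`S`, so `T_Θ^* S^* T_Θ u = S^* T_Θ^* T_Θ u = S^* u = 0` for a sequence
`u = (u₀, 0, 0, …)`, and `S^* T_Θ u` belongs to `Ker T_Θ^* = ℳ_Φ`
(`adjoint_toeplitz_eq_zero_of_shift`). Since `T_Φ` has dense range, `T_Φ^*` is injective, and so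
`T_Φ^* f = W_obs x = T_Φ^* W_{Φ,obs} x` gives `f = W_{Φ,obs} x`: thus `ℳ_Φ ⊆ W_{Φ,obs} 𝒳_Φ`
(`exists_obsOp_eq_of_mem_spaceM`). The relation between `Θ(ζ)` being unitary on the circle and the
orthogonality of the coefficient sequences comes from integrating over the circle
(`hasSum_inner_shift_of_inner_eq`). The formula for `Θ(z)` then holds in the unit disc by the
Neumann series, and extends by rationality (`ratEval_eq_of_taylorCoeff_succ`).

The two identities are inner products in `ℓ²₊`, in which the entry at `0` contributes the terms
with `D_Θ` and the rest those with the Gramian: the first says that `T_Θ u` is orthogonal to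
`W_{Φ,obs} 𝒳_Φ ⊆ Ker T_Θ^*`, the second that `T_Θ` is isometric on sequences
concentrated at `0`.
-/

/-! ### Power series on the unit circle -/

theorem norm_exp_ofReal_mul_I_zpow (θ : ℝ) (j : ℤ) :
    ‖Complex.exp (θ * Complex.I) ^ j‖ = 1 := by
  rw [norm_zpow, Complex.norm_exp_ofReal_mul_I, one_zpow]

theorem integral_exp_ofReal_mul_I_zpow (j : ℤ) :
    ∫ θ in (0 : ℝ)..(2 * Real.pi), Complex.exp (θ * Complex.I) ^ j =
      if j = 0 then (2 * Real.pi : ℂ) else 0 := by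
  split_ifs with hj
  · subst hj
    simp
  · have hc : (j : ℂ) * Complex.I ≠ 0 := mul_ne_zero (by exact_mod_cast hj) Complex.I_ne_zero
    have h : ∀ θ : ℝ, Complex.exp (θ * Complex.I) ^ j = Complex.exp ((j : ℂ) * Complex.I * θ) := by
      intro θ
      rw [← Complex.exp_int_mul]
      congr 1
      ring
    simp_rw [h]
    rw [integral_exp_mul_complex hc]
    have h1 : (j : ℂ) * Complex.I * ((2 * Real.pi : ℝ) : ℂ) = j * (2 * Real.pi * Complex.I) := by
      push_cast
      ring
    rw [h1, Complex.exp_int_mul_two_pi_mul_I]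
    simp

theorem continuous_exp_ofReal_mul_I_zpow (j : ℤ) :
    Continuous fun θ : ℝ => Complex.exp (θ * Complex.I) ^ j := by
  refine Continuous.zpow₀ (by fun_prop) j fun θ => Or.inl (Complex.exp_ne_zero _)

theorem norm_le_of_hasSum_pow_smul {E : Type*} [NormedAddCommGroup E]
    [NormedSpace ℂ E] {b : ℕ → E} {g : E} (hb : Summable fun μ => ‖b μ‖)
    {ζ : ℂ} (hζ : ‖ζ‖ = 1) (hg : HasSum (fun μ => ζ ^ μ • b μ) g) : ‖g‖ ≤ ∑' μ, ‖b μ‖ := by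
  have h : (fun μ => ‖ζ ^ μ • b μ‖) = fun μ => ‖b μ‖ := by
    funext μ
    rw [norm_smul, norm_pow, hζ, one_pow, one_mul]
  rw [← hg.tsum_eq]
  exact (norm_tsum_le_tsum_norm (h ▸ hb)).trans (le_of_eq (by rw [h]))

section

variable {E : Type*} [NormedAddCommGroup E] [InnerProductSpace ℂ E] [CompleteSpace E]

/-- Absolute convergence of the coefficients makes the sum of a power series continuous along
the unit circle. -/
theorem continuous_of_hasSum_pow_smul {b : ℕ → E} {G : ℂ → E} (hb : Summable fun μ => ‖b μ‖)
    (hG : ∀ ζ : ℂ, ‖ζ‖ = 1 → HasSum (fun μ => ζ ^ μ • b μ) (G ζ)) :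
    Continuous fun θ : ℝ => G (Complex.exp (θ * Complex.I)) := by
  have h : (fun θ : ℝ => G (Complex.exp (θ * Complex.I))) =
      fun θ : ℝ => ∑' μ, Complex.exp (θ * Complex.I) ^ μ • b μ := by
    funext θ
    exact (hG _ (Complex.norm_exp_ofReal_mul_I θ)).tsum_eq.symm
  rw [h]
  refine continuous_tsum (fun μ => by fun_prop) hb fun μ θ => ?_
  rw [norm_smul, norm_pow, Complex.norm_exp_ofReal_mul_I, one_pow, one_mul]

/-- The Fourier coefficients of an absolutely convergent power series. -/
theorem integral_zpow_mul_of_hasSum {b : ℕ → ℂ} {G : ℂ → ℂ} (hb : Summable fun μ => ‖b μ‖)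
    (hG : ∀ ζ : ℂ, ‖ζ‖ = 1 → HasSum (fun μ => ζ ^ μ • b μ) (G ζ)) (k ν : ℕ) :
    ∫ θ in (0 : ℝ)..(2 * Real.pi),
      Complex.exp (θ * Complex.I) ^ ((k : ℤ) - ν) * G (Complex.exp (θ * Complex.I)) =
      2 * Real.pi * if k ≤ ν then b (ν - k) else 0 := by
  have h := intervalIntegral.hasSum_integral_of_dominated_convergence
    (μ := MeasureTheory.volume) (a := 0) (b := 2 * Real.pi)
    (F := fun (μ : ℕ) (θ : ℝ) => Complex.exp (θ * Complex.I) ^ ((k : ℤ) - ν + μ) * b μ)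
    (f := fun θ : ℝ => Complex.exp (θ * Complex.I) ^ ((k : ℤ) - ν) *
      G (Complex.exp (θ * Complex.I)))
    (fun μ _ => ‖b μ‖)
    (fun μ => ((continuous_exp_ofReal_mul_I_zpow _).mul continuous_const).aestronglyMeasurable)
    (fun μ => Filter.Eventually.of_forall fun θ _ => by
      rw [norm_mul, norm_exp_ofReal_mul_I_zpow, one_mul])
    (Filter.Eventually.of_forall fun θ _ => hb)
    intervalIntegrable_const
    (Filter.Eventually.of_forall fun θ _ => by
      have := (hG _ (Complex.norm_exp_ofReal_mul_I θ)).mul_left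
        (Complex.exp (θ * Complex.I) ^ ((k : ℤ) - ν))
      refine this.congr_fun fun μ => ?_
      rw [zpow_add₀ (Complex.exp_ne_zero _), zpow_natCast, smul_eq_mul, mul_assoc])
  refine h.unique ?_
  simp_rw [intervalIntegral.integral_mul_const, integral_exp_ofReal_mul_I_zpow]
  split_ifs with hk
  · convert! hasSum_ite_eq (ν - k) (2 * Real.pi * b (ν - k)) using 1
    funext μ
    have : ((k : ℤ) - ν + μ = 0) ↔ μ = ν - k := by omega
    simp only [this]
    split_ifs with hμ
    · rw [hμ]
    · rw [zero_mul]
  · convert! hasSum_zero using 1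
    · funext μ
      rw [if_neg (by omega), zero_mul]
    · rw [mul_zero]

/-- If two absolutely convergent power series have constant pointwise inner product on the unit
circle, then their coefficient sequences have that same inner product in `ℓ²`, and become
orthogonal when the second is shifted forward by `k > 0` places. -/
theorem hasSum_inner_shift_of_inner_eq {a b : ℕ → E} {F G : ℂ → E} {d : ℂ}
    (ha : Summable fun ν => ‖a ν‖) (hb : Summable fun ν => ‖b ν‖)
    (hF : ∀ ζ : ℂ, ‖ζ‖ = 1 → HasSum (fun ν => ζ ^ ν • a ν) (F ζ))
    (hG : ∀ ζ : ℂ, ‖ζ‖ = 1 → HasSum (fun ν => ζ ^ ν • b ν) (G ζ))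
    (hd : ∀ ζ : ℂ, ‖ζ‖ = 1 → inner ℂ (F ζ) (G ζ) = d) (k : ℕ) :
    HasSum (fun ν => inner ℂ (a ν) (if k ≤ ν then b (ν - k) else 0))
      (if k = 0 then d else 0) := by
  have hGc := continuous_of_hasSum_pow_smul hb hG
  have h := intervalIntegral.hasSum_integral_of_dominated_convergence
    (μ := MeasureTheory.volume) (a := 0) (b := 2 * Real.pi)
    (F := fun (ν : ℕ) (θ : ℝ) => Complex.exp (θ * Complex.I) ^ ((k : ℤ) - ν) *
      inner ℂ (a ν) (G (Complex.exp (θ * Complex.I))))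
    (f := fun θ : ℝ => Complex.exp (θ * Complex.I) ^ (k : ℤ) * d)
    (fun ν _ => ‖a ν‖ * ∑' μ, ‖b μ‖)
    (fun ν => ((continuous_exp_ofReal_mul_I_zpow _).mul
      (continuous_const.inner hGc)).aestronglyMeasurable)
    (fun ν => Filter.Eventually.of_forall fun θ _ => by
      rw [norm_mul, norm_exp_ofReal_mul_I_zpow, one_mul]
      exact (norm_inner_le_norm _ _).trans (mul_le_mul_of_nonneg_left
        (norm_le_of_hasSum_pow_smul hb (Complex.norm_exp_ofReal_mul_I θ)
          (hG _ (Complex.norm_exp_ofReal_mul_I θ))) (norm_nonneg _)))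
    (Filter.Eventually.of_forall fun θ _ => ha.mul_right _)
    intervalIntegrable_const
    (Filter.Eventually.of_forall fun θ _ => by
      have hζ := Complex.norm_exp_ofReal_mul_I θ
      set ζ := Complex.exp (θ * Complex.I)
      have hζ0 : ζ ≠ 0 := Complex.exp_ne_zero _
      have h1 : HasSum (fun ν => inner ℂ (ζ ^ ν • a ν) (G ζ)) (inner ℂ (F ζ) (G ζ)) := by
        have h2 := ((hF ζ hζ).mapL (innerSL ℂ (G ζ))).map (starRingEnd ℂ) Complex.continuous_conj
        refine HasSum.congr_fun (f := (starRingEnd ℂ) ∘ fun ν => innerSL ℂ (G ζ) (ζ ^ ν • a ν)) ?_ ?_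
        · simpa only [innerSL_apply_apply, inner_conj_symm] using h2
        · intro ν
          simp only [Function.comp, innerSL_apply_apply, inner_conj_symm]
      rw [hd ζ hζ] at h1
      refine (h1.mul_left (ζ ^ (k : ℤ))).congr_fun fun ν => ?_
      rw [inner_smul_left, zpow_sub₀ hζ0, zpow_natCast, zpow_natCast, map_pow,
        ← Complex.inv_eq_conj hζ, inv_pow, div_eq_mul_inv, mul_assoc])
  have hG' : ∀ ν, ∀ ζ : ℂ, ‖ζ‖ = 1 →
      HasSum (fun μ => ζ ^ μ • inner ℂ (a ν) (b μ)) (inner ℂ (a ν) (G ζ)) := by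
    intro ν ζ hζ
    refine ((hG ζ hζ).mapL (innerSL ℂ (a ν))).congr_fun fun μ => ?_
    rw [map_smul]
    rfl
  have hb' : ∀ ν, Summable fun μ => ‖inner ℂ (a ν) (b μ)‖ := fun ν =>
    Summable.of_nonneg_of_le (fun _ => norm_nonneg _) (fun μ => norm_inner_le_norm _ _)
      (hb.mul_left ‖a ν‖)
  simp_rw [integral_zpow_mul_of_hasSum (hb' _) (hG' _), intervalIntegral.integral_mul_const,
    integral_exp_ofReal_mul_I_zpow] at h
  have hpi : (2 * Real.pi : ℂ) ≠ 0 := by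
    exact_mod_cast (by positivity : (2 * Real.pi : ℝ) ≠ 0)
  have h3 := h.mul_left (2 * Real.pi : ℂ)⁻¹
  convert! h3 using 1
  · funext ν
    rw [inv_mul_cancel_left₀ hpi]
    split_ifs <;> simp
  · simp only [Nat.cast_eq_zero]
    split_ifs
    · rw [inv_mul_cancel_left₀ hpi]
    · simp

end

/-! ### Taylor expansion of stable rational matrix functions -/

/-- A rational function without poles in the closed unit disc is the sum of its Taylor series
there, the boundary included. -/
theorem hasSum_taylorCoeff {k l : ℕ} {Ω : Matrix (Fin k) (Fin l) (RatFunc ℂ)}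
    (hΩ : IsStableRational Ω) (i : Fin k) (j : Fin l) {z : ℂ} (hz : ‖z‖ ≤ 1) :
    HasSum (fun ν => z ^ ν * taylorCoeff Ω ν i j) (ratEval Ω z i j) := by
  have hopen : IsOpen {z : ℂ | (Ω i j).denom.eval z ≠ 0} :=
    isOpen_ne_fun (Ω i j).denom.continuous continuous_const
  have hsub : Metric.closedBall (0 : ℂ) 1 ⊆ {z : ℂ | (Ω i j).denom.eval z ≠ 0} := by
    intro z hz
    exact hΩ i j z (by simpa using hz)
  obtain ⟨δ, hδ, hδs⟩ := (isCompact_closedBall (0 : ℂ) 1).exists_thickening_subset_open hopen hsub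
  rw [thickening_closedBall hδ zero_le_one] at hδs
  have hdiff : DifferentiableOn ℂ (fun z : ℂ => (Ω i j).eval (RingHom.id ℂ) z)
      (Metric.ball 0 (δ + 1)) := by
    intro w hw
    have : DifferentiableAt ℂ
        (fun z : ℂ => (Ω i j).num.eval z / (Ω i j).denom.eval z) w :=
      (Ω i j).num.differentiableAt.div (Ω i j).denom.differentiableAt (hδs hw)
    exact this.differentiableWithinAt
  have hzb : z ∈ Metric.ball (0 : ℂ) (δ + 1) := by
    rw [mem_ball_zero_iff]
    linarith
  refine (Complex.hasSum_taylorSeries_on_ball hdiff hzb).congr_fun fun ν => ?_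
  simp only [taylorCoeff, Matrix.of_apply, sub_zero, smul_eq_mul]
  rw [div_eq_mul_inv]
  ring

theorem hasSum_toEuclideanLin_taylorCoeff {k l : ℕ} {Ω : Matrix (Fin k) (Fin l) (RatFunc ℂ)}
    (hΩ : IsStableRational Ω) (u : EuclideanSpace ℂ (Fin l)) {z : ℂ} (hz : ‖z‖ ≤ 1) :
    HasSum (fun ν => z ^ ν • Matrix.toEuclideanLin (taylorCoeff Ω ν) u)
      (Matrix.toEuclideanLin (ratEval Ω z) u) := by
  have h : HasSum (fun ν i => ∑ j, z ^ ν * taylorCoeff Ω ν i j * u j)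
      (fun i => ∑ j, ratEval Ω z i j * u j) :=
    Pi.hasSum.2 fun i => hasSum_sum fun j _ => (hasSum_taylorCoeff hΩ i j hz).mul_right (u j)
  have h2 := h.mapL (EuclideanSpace.equiv (Fin k) ℂ).symm.toContinuousLinearMap
  convert! h2 using 1
  funext ν
  ext i
  simp [Matrix.toLpLin_apply, Matrix.mulVec, dotProduct, Finset.mul_sum, mul_assoc]

theorem summable_norm_toEuclideanLin_taylorCoeff {k l : ℕ}
    {Ω : Matrix (Fin k) (Fin l) (RatFunc ℂ)} (hΩ : IsStableRational Ω)
    (u : EuclideanSpace ℂ (Fin l)) :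
    Summable fun ν => ‖Matrix.toEuclideanLin (taylorCoeff Ω ν) u‖ := by
  have hs : Summable fun ν => ∑ i, ∑ j, ‖taylorCoeff Ω ν i j‖ * ‖u j‖ :=
    summable_sum fun i _ => summable_sum fun j _ =>
      (summable_norm_taylorCoeff hΩ i j).mul_right _
  refine Summable.of_nonneg_of_le (fun _ => norm_nonneg _) (fun ν => ?_) hs
  rw [EuclideanSpace.norm_eq]
  refine (Real.sqrt_le_sqrt (Finset.sum_sq_le_sq_sum_of_nonneg fun i _ => norm_nonneg _)).trans ?_
  rw [Real.sqrt_sq (Finset.sum_nonneg fun i _ => norm_nonneg _)]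
  refine Finset.sum_le_sum fun i _ => ?_
  simp only [Matrix.toLpLin_apply, Matrix.mulVec, dotProduct]
  exact (norm_sum_le _ _).trans (Finset.sum_le_sum fun j _ => (norm_mul _ _).le)

/-! ### Isometric Toeplitz operators -/

theorem toeplitz_single_apply {k l : ℕ} (Ω : Matrix (Fin k) (Fin l) (RatFunc ℂ))
    (hΩ : IsStableRational Ω) (κ : ℕ) (u : EuclideanSpace ℂ (Fin l)) (i : ℕ) :
    (toeplitz Ω hΩ (lp.single 2 κ u) : ℕ → EuclideanSpace ℂ (Fin k)) i =
      if κ ≤ i then Matrix.toEuclideanLin (taylorCoeff Ω (i - κ)) u else 0 := by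
  rw [toeplitz_apply]
  have h : ∀ j ∈ Finset.range (i + 1), Matrix.toEuclideanLin (taylorCoeff Ω (i - j))
      ((lp.single 2 κ u : EllTwo l) j) =
      if j = κ then Matrix.toEuclideanLin (taylorCoeff Ω (i - κ)) u else 0 := by
    intro j _
    split_ifs with hj
    · rw [hj, lp.single_apply_self]
    · rw [lp.single_apply_ne _ _ _ hj, map_zero]
  rw [Finset.sum_congr rfl h, Finset.sum_ite_eq']
  simp only [Finset.mem_range, Nat.lt_succ_iff]

/-- For inner `Θ`, the operator `T_Θ` is an isometry commuting with the shift; this is the part of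
that fact that concerns the images of sequences with a single nonzero entry. -/
theorem inner_toeplitz_single {r : ℕ} {Θ : Matrix (Fin r) (Fin r) (RatFunc ℂ)}
    (hΘ : IsStableRational Θ) (hinner : IsTwoSidedInner Θ) (κ : ℕ)
    (u v : EuclideanSpace ℂ (Fin r)) :
    inner ℂ (toeplitz Θ hΘ (lp.single 2 0 u)) (toeplitz Θ hΘ (lp.single 2 κ v)) =
      if κ = 0 then inner ℂ u v else 0 := by
  have h := hasSum_inner_shift_of_inner_eq
    (summable_norm_toEuclideanLin_taylorCoeff hΘ u) (summable_norm_toEuclideanLin_taylorCoeff hΘ v)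
    (fun ζ hζ => hasSum_toEuclideanLin_taylorCoeff hΘ u hζ.le)
    (fun ζ hζ => hasSum_toEuclideanLin_taylorCoeff hΘ v hζ.le) (d := inner ℂ u v)
    (fun ζ hζ => by
      rw [← LinearMap.adjoint_inner_right, ← Matrix.toEuclideanLin_conjTranspose_eq_adjoint]
      have h1 : (ratEval Θ ζ)ᴴ * ratEval Θ ζ = 1 := Matrix.mem_unitaryGroup_iff'.1 (hinner ζ hζ)
      simp [Matrix.toLpLin_apply, Matrix.mulVec_mulVec, h1]) κ
  refine HasSum.unique ?_ h
  refine (lp.hasSum_inner (𝕜 := ℂ) (toeplitz Θ hΘ (lp.single 2 0 u))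
    (toeplitz Θ hΘ (lp.single 2 κ v))).congr_fun fun ν => ?_
  rw [toeplitz_single_apply, toeplitz_single_apply, if_pos (Nat.zero_le ν), Nat.sub_zero]

theorem exists_backwardShift {k : ℕ} (f : EllTwo k) :
    ∃ h : EllTwo k, ∀ ν, (f : ℕ → EuclideanSpace ℂ (Fin k)) (ν + 1) = h ν := by
  refine ⟨⟨fun ν => f (ν + 1), memℓp_gen ?_⟩, fun ν => rfl⟩
  have h2 : 0 < (2 : ENNReal).toReal := by norm_num
  exact (summable_nat_add_iff 1).2 (lp.hasSum_norm h2 f).summable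

/-- Splitting the entry at `0` off an inner product in `ℓ²`: here `f'` and `g'` are the backward
shifts of `f` and `g`. -/
theorem inner_eq_inner_zero_add_inner_shift {k : ℕ} {f g f' g' : EllTwo k}
    (hf : ∀ ν, (f : ℕ → EuclideanSpace ℂ (Fin k)) (ν + 1) = f' ν)
    (hg : ∀ ν, (g : ℕ → EuclideanSpace ℂ (Fin k)) (ν + 1) = g' ν) :
    inner ℂ f g = inner ℂ (f 0) (g 0) + inner ℂ f' g' := by
  have h := lp.hasSum_inner (𝕜 := ℂ) f g
  rw [← hasSum_nat_add_iff' 1] at h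
  simp only [hf, hg, Finset.sum_range_one] at h
  rw [(lp.hasSum_inner (𝕜 := ℂ) f' g').unique h]
  ring

/-- For inner `Θ` the columns of `(Θ(z) - Θ(0)) / z` lie in `Ker T_Θ^*`. -/
theorem adjoint_toeplitz_eq_zero_of_shift {r : ℕ} {Θ : Matrix (Fin r) (Fin r) (RatFunc ℂ)}
    (hΘ : IsStableRational Θ) (hinner : IsTwoSidedInner Θ) {u : EuclideanSpace ℂ (Fin r)}
    {h : EllTwo r}
    (hh : ∀ ν, (toeplitz Θ hΘ (lp.single 2 0 u) : ℕ → EuclideanSpace ℂ (Fin r)) (ν + 1) = h ν) :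
    ContinuousLinearMap.adjoint (toeplitz Θ hΘ) h = 0 := by
  have key : ∀ (κ : ℕ) (v : EuclideanSpace ℂ (Fin r)),
      inner ℂ ((ContinuousLinearMap.adjoint (toeplitz Θ hΘ) h : EllTwo r) κ) v = 0 := by
    intro κ v
    rw [← lp.inner_single_right, ContinuousLinearMap.adjoint_inner_left]
    have h1 := inner_toeplitz_single hΘ hinner (κ + 1) u v
    rw [inner_eq_inner_zero_add_inner_shift hh (g' := toeplitz Θ hΘ (lp.single 2 κ v))] at h1
    · rw [toeplitz_single_apply Θ hΘ (κ + 1), if_neg (by omega), if_neg (by omega),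
        inner_zero_right, zero_add] at h1
      exact h1
    · intro ν
      simp only [toeplitz_single_apply, add_le_add_iff_right, Nat.add_sub_add_right]
  ext1
  funext κ
  exact inner_self_eq_zero.1 (key κ _)

/-! ### Observability operators and the spaces `𝒳_Φ` and `ℳ_Φ` -/

theorem obsOp_apply {n k : ℕ} {A : Matrix (Fin n) (Fin n) ℂ} (hA : IsStableMatrix A)
    (C : Matrix (Fin k) (Fin n) ℂ) (x : EuclideanSpace ℂ (Fin n)) (ν : ℕ) :
    (obsOp C A hA x : ℕ → EuclideanSpace ℂ (Fin k)) ν = Matrix.toEuclideanLin (C * A ^ ν) x :=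
  rfl

theorem inner_single_toEuclideanLin_single {k l : ℕ} (M : Matrix (Fin k) (Fin l) ℂ) (a : Fin k)
    (b : Fin l) :
    inner ℂ (EuclideanSpace.single a 1) (Matrix.toEuclideanLin M (EuclideanSpace.single b 1)) =
      M a b := by
  simp [Matrix.toLpLin_apply, EuclideanSpace.inner_single_left]

theorem inner_toEuclideanLin_conjTranspose {k l : ℕ} (M : Matrix (Fin k) (Fin l) ℂ)
    (x : EuclideanSpace ℂ (Fin l)) (y : EuclideanSpace ℂ (Fin k)) :
    inner ℂ x (Matrix.toEuclideanLin Mᴴ y) = inner ℂ (Matrix.toEuclideanLin M x) y := by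
  rw [Matrix.toEuclideanLin_conjTranspose_eq_adjoint, LinearMap.adjoint_inner_right]

theorem toEuclideanLin_mul_apply {k l p : ℕ} (M : Matrix (Fin k) (Fin l) ℂ)
    (N : Matrix (Fin l) (Fin p) ℂ) (x : EuclideanSpace ℂ (Fin p)) :
    Matrix.toEuclideanLin (M * N) x = Matrix.toEuclideanLin M (Matrix.toEuclideanLin N x) := by
  simp [Matrix.toLpLin_apply, Matrix.mulVec_mulVec]

/-- The Gramian is the matrix of `W_obs^* W_obs`. -/
theorem inner_obsOp_obsOp {n k : ℕ} {A : Matrix (Fin n) (Fin n) ℂ} (hA : IsStableMatrix A)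
    (C : Matrix (Fin k) (Fin n) ℂ) (x y : EuclideanSpace ℂ (Fin n)) :
    inner ℂ (obsOp C A hA x) (obsOp C A hA y) =
      inner ℂ x (Matrix.toEuclideanLin (obsGramian C A) y) := by
  have hx : ∀ z : EuclideanSpace ℂ (Fin n), z = ∑ i, z i • EuclideanSpace.single i (1 : ℂ) := by
    intro z
    ext j
    simp [Pi.single_apply]
  conv_lhs => rw [hx x, hx y]
  conv_rhs => rw [hx x, hx y]
  simp only [map_sum, map_smul, sum_inner, inner_sum, inner_smul_left, inner_smul_right,
    inner_single_toEuclideanLin_single]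
  simp only [obsGramian, (hasSum_obsGramian C A hA).tsum_eq, Matrix.of_apply]

theorem adjoint_toeplitz_injective {m r : ℕ} {Φ : Matrix (Fin r) (Fin m) (RatFunc ℂ)}
    {hΦ : IsStableRational Φ} (h : DenseRange (toeplitz Φ hΦ)) :
    Function.Injective (ContinuousLinearMap.adjoint (toeplitz Φ hΦ)) := by
  refine (injective_iff_map_eq_zero _).2 fun f hf => ?_
  refine h.eq_zero_of_inner_left (𝕜 := ℂ) fun g => ?_
  rw [← ContinuousLinearMap.adjoint_inner_left, hf, inner_zero_left]

/-- `ℳ_Φ ⊆ W_{Φ,obs} 𝒳_Φ`. -/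
theorem exists_obsOp_eq_of_mem_spaceM {m n r : ℕ} {A : Matrix (Fin n) (Fin n) ℂ}
    {C : Matrix (Fin m) (Fin n) ℂ} {hA : IsStableMatrix A}
    {Φ : Matrix (Fin r) (Fin m) (RatFunc ℂ)} {hΦ : IsStableRational Φ}
    (hdense : DenseRange (toeplitz Φ hΦ)) {CΦ : Matrix (Fin r) (Fin n) ℂ}
    (hCΦ : ∀ x ∈ spaceX C A hA Φ hΦ,
      obsOp C A hA x = ContinuousLinearMap.adjoint (toeplitz Φ hΦ) (obsOp CΦ A hA x))
    {f : EllTwo r} (hf : f ∈ spaceM C A hA Φ hΦ) :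
    ∃ x, obsOp CΦ A hA x = f := by
  obtain ⟨x, hx⟩ := hf
  have hx' : obsOp C A hA x = ContinuousLinearMap.adjoint (toeplitz Φ hΦ) f := hx
  refine ⟨x, adjoint_toeplitz_injective hdense ?_⟩
  rw [← hx', hCΦ x ⟨f, hx'.symm⟩]

theorem obsOp_mem_spaceM {m n r : ℕ} {A : Matrix (Fin n) (Fin n) ℂ}
    {C : Matrix (Fin m) (Fin n) ℂ} {hA : IsStableMatrix A}
    {Φ : Matrix (Fin r) (Fin m) (RatFunc ℂ)} {hΦ : IsStableRational Φ}
    {CΦ : Matrix (Fin r) (Fin n) ℂ}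
    (hCΦ : ∀ x ∈ spaceX C A hA Φ hΦ,
      obsOp C A hA x = ContinuousLinearMap.adjoint (toeplitz Φ hΦ) (obsOp CΦ A hA x))
    {x : EuclideanSpace ℂ (Fin n)} (hx : x ∈ spaceX C A hA Φ hΦ) :
    obsOp CΦ A hA x ∈ spaceM C A hA Φ hΦ :=
  ⟨x, hCΦ x hx⟩

/-! ### Realization of a rational matrix function -/

theorem summable_pow_smul {n : ℕ} {A : Matrix (Fin n) (Fin n) ℂ} (hA : IsStableMatrix A)
    {z : ℂ} (hz : ‖z‖ ≤ 1) : Summable fun ν : ℕ => (z • A) ^ ν := by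
  refine Pi.summable.2 fun i => Pi.summable.2 fun j => ?_
  refine Summable.of_norm_bounded
    (summable_norm_pow_mulVec hA (1 : Matrix (Fin n) (Fin n) ℂ) (EuclideanSpace.single j 1))
    fun ν => ?_
  have h1 : ‖(A ^ ν) i j‖ ≤
      ‖Matrix.toEuclideanLin ((1 : Matrix (Fin n) (Fin n) ℂ) * A ^ ν)
        (EuclideanSpace.single j 1)‖ := by
    refine le_trans (le_of_eq ?_) (PiLp.norm_apply_le _ i)
    rw [one_mul, Matrix.toLpLin_apply]
    simp
  refine le_trans ?_ h1
  rw [smul_pow, Matrix.smul_apply, norm_smul, norm_pow]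
  exact mul_le_of_le_one_left (norm_nonneg _) (pow_le_one₀ (norm_nonneg _) hz)

/-- The Neumann series of a stable matrix on the closed unit disc. -/
theorem isUnit_and_hasSum_pow_smul {n : ℕ} {A : Matrix (Fin n) (Fin n) ℂ} (hA : IsStableMatrix A)
    {z : ℂ} (hz : ‖z‖ ≤ 1) :
    IsUnit (1 - z • A) ∧ HasSum (fun ν : ℕ => (z • A) ^ ν) (1 - z • A)⁻¹ := by
  have hs := summable_pow_smul hA hz
  have h1 := hs.one_sub_mul_tsum_pow
  have h2 := hs.tsum_pow_mul_one_sub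
  refine ⟨⟨⟨_, _, h1, h2⟩, rfl⟩, ?_⟩
  rw [Matrix.inv_eq_right_inv h1]
  exact hs.hasSum

/-- If a rational function agrees with a quotient `q / p` of polynomials on the open unit disc,
then it has no pole off the zeros of `p`, and it agrees with `q / p` there. -/
theorem ratFunc_eval_eq_div {f : RatFunc ℂ} {p q : Polynomial ℂ}
    (hf : ∀ z : ℂ, ‖z‖ < 1 → f.denom.eval z ≠ 0) (hp : ∀ z : ℂ, ‖z‖ < 1 → p.eval z ≠ 0)
    (h : ∀ z : ℂ, ‖z‖ < 1 → f.eval (RingHom.id ℂ) z = q.eval z / p.eval z) {z : ℂ}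
    (hz : p.eval z ≠ 0) : f.eval (RingHom.id ℂ) z = q.eval z / p.eval z := by
  have hdef : ∀ w, f.eval (RingHom.id ℂ) w = f.num.eval w / f.denom.eval w := fun w => rfl
  have hpoly : f.num * p = q * f.denom := by
    refine Polynomial.eq_of_infinite_eval_eq _ _ (Set.Infinite.mono (s := Metric.ball (0 : ℂ) 1)
      (fun w hw => ?_) (infinite_of_mem_nhds (0 : ℂ) (Metric.ball_mem_nhds 0 one_pos)))
    have hw' : ‖w‖ < 1 := by simpa using hw
    have h1 := h w hw'
    rw [hdef, div_eq_div_iff (hf w hw') (hp w hw')] at h1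
    simpa using h1
  have heval := congrArg (Polynomial.eval z) hpoly
  simp only [Polynomial.eval_mul] at heval
  -- A common zero of numerator and denominator would contradict their coprimality.
  have hden : f.denom.eval z ≠ 0 := by
    intro h0
    rw [h0, mul_zero] at heval
    obtain ⟨a, b, hab⟩ := RatFunc.isCoprime_num_denom f
    have h1 := congrArg (Polynomial.eval z) hab
    simp [h0, (mul_eq_zero.1 heval).resolve_right hz] at h1
  rw [hdef, div_eq_div_iff hden hz, heval]

/-- A rational matrix function in `ℜH^∞` with Taylor coefficients `Ω_{ν+1} = C A^ν B` is given by
`Ω(z) = Ω_0 + z C (I - z A)⁻¹ B` wherever the right hand side is defined. -/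
theorem ratEval_eq_of_taylorCoeff_succ {n k l : ℕ} {A : Matrix (Fin n) (Fin n) ℂ}
    (hA : IsStableMatrix A) {C : Matrix (Fin k) (Fin n) ℂ} {B : Matrix (Fin n) (Fin l) ℂ}
    {Ω : Matrix (Fin k) (Fin l) (RatFunc ℂ)} (hΩ : IsStableRational Ω)
    (h : ∀ ν, taylorCoeff Ω (ν + 1) = C * A ^ ν * B) {z : ℂ} (hz : IsUnit (1 - z • A)) :
    ratEval Ω z = taylorCoeff Ω 0 + z • (C * (1 - z • A)⁻¹ * B) := by
  have hdisc : ∀ w : ℂ, ‖w‖ < 1 →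
      ratEval Ω w = taylorCoeff Ω 0 + w • (C * (1 - w • A)⁻¹ * B) := by
    intro w hw
    have h1 : HasSum (fun ν => w • (C * (w • A) ^ ν * B)) (w • (C * (1 - w • A)⁻¹ * B)) :=
      (isUnit_and_hasSum_pow_smul hA hw.le).2.map
        (AddMonoidHom.mk' (fun M : Matrix (Fin n) (Fin n) ℂ => w • (C * M * B)) fun M M' => by
          rw [Matrix.mul_add, Matrix.add_mul, smul_add])
        (((continuous_const.matrix_mul continuous_id).matrix_mul continuous_const).const_smul w)
    ext i j
    have h2 := hasSum_taylorCoeff hΩ i j hw.le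
    rw [← hasSum_nat_add_iff' 1] at h2
    simp only [Finset.sum_range_one, pow_zero, one_mul] at h2
    have h3 := Pi.hasSum.1 (Pi.hasSum.1 h1 i) j
    have h4 := h3.unique (h2.congr_fun fun ν => by
      rw [h ν, smul_pow, Matrix.mul_smul, Matrix.smul_mul]
      simp only [Matrix.smul_apply, smul_eq_mul]
      ring)
    rw [Matrix.add_apply, h4]
    ring
  -- Both sides are rational: clear denominators with `det (1 - X A)`.
  let N : Matrix (Fin n) (Fin n) (Polynomial ℂ) :=
    1 - (Polynomial.X : Polynomial ℂ) • A.map Polynomial.C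
  have hN : ∀ w : ℂ, (Polynomial.evalRingHom w).mapMatrix N = 1 - w • A := by
    intro w
    ext i j
    simp [N, Matrix.one_apply, apply_ite (Polynomial.eval w), mul_comm w]
  have hdet : ∀ w : ℂ, N.det.eval w = (1 - w • A).det := by
    intro w
    rw [← hN w, ← RingHom.map_det]
    rfl
  have hadj : ∀ w : ℂ, N.adjugate.map (Polynomial.eval w) = (1 - w • A).adjugate := by
    intro w
    rw [← hN w, ← RingHom.map_adjugate]
    rfl
  have hunit : ∀ w : ℂ, IsUnit (1 - w • A) ↔ N.det.eval w ≠ 0 := by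
    intro w
    rw [hdet, Matrix.isUnit_iff_isUnit_det, isUnit_iff_ne_zero]
  ext i j
  let q : Polynomial ℂ := Polynomial.C (taylorCoeff Ω 0 i j) * N.det +
    Polynomial.X * (C.map Polynomial.C * N.adjugate * B.map Polynomial.C) i j
  have hq : ∀ w : ℂ, N.det.eval w ≠ 0 →
      (taylorCoeff Ω 0 + w • (C * (1 - w • A)⁻¹ * B)) i j = q.eval w / N.det.eval w := by
    intro w hw
    have h1 : ((C.map Polynomial.C * N.adjugate * B.map Polynomial.C) i j).eval w =
        (C * (1 - w • A).adjugate * B) i j := by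
      rw [← hadj w]
      simp [Matrix.mul_apply, Polynomial.eval_finsetSum]
    rw [eq_div_iff hw]
    simp only [q, Polynomial.eval_add, Polynomial.eval_mul, Polynomial.eval_C, Polynomial.eval_X,
      h1]
    rw [Matrix.inv_def, ← hdet w, Ring.inverse_eq_inv, Matrix.mul_smul, Matrix.smul_mul]
    simp only [Matrix.add_apply, Matrix.smul_apply, smul_eq_mul]
    field_simp
  have hp : ∀ w : ℂ, ‖w‖ < 1 → N.det.eval w ≠ 0 := fun w hw =>
    (hunit w).1 (isUnit_and_hasSum_pow_smul hA hw.le).1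
  rw [hq z ((hunit z).1 hz)]
  refine ratFunc_eval_eq_div (f := Ω i j) (fun w hw => hΩ i j w hw.le) hp (fun w hw => ?_)
    ((hunit z).1 hz)
  rw [← hq w (hp w hw), ← hdisc w hw]
  rfl

/-! ### Realization of the inner function -/

theorem proposition2p4 {m n r : ℕ}
    (A : Matrix (Fin n) (Fin n) ℂ) (C : Matrix (Fin m) (Fin n) ℂ)
    (Γ : Matrix (Fin n) (Fin m) ℂ) (R₀ : Matrix (Fin m) (Fin m) ℂ)
    (hA : IsStableMatrix A)
    (hR : ∀ ζ : ℂ, ‖ζ‖ = 1 → (weightR A C Γ R₀ ζ).PosSemidef)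
    (Φ : Matrix (Fin r) (Fin m) (RatFunc ℂ)) (hΦ : IsStableRational Φ)
    (hΦR : IsOuterSpectralFactor (weightR A C Γ R₀) Φ hΦ)
    (CΦ : Matrix (Fin r) (Fin n) ℂ)
    (hCΦ : ∀ x ∈ spaceX C A hA Φ hΦ,
      obsOp C A hA x = ContinuousLinearMap.adjoint (toeplitz Φ hΦ) (obsOp CΦ A hA x))
    (hobs : IsObservable C A hA)
    (Θ : Matrix (Fin r) (Fin r) (RatFunc ℂ)) (hΘ : IsStableRational Θ)
    (hinner : IsTwoSidedInner Θ)
    (hker : LinearMap.ker (ContinuousLinearMap.adjoint (toeplitz Θ hΘ)).toLinearMap =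
      spaceM C A hA Φ hΦ) :
    ∃ (BΘ : Matrix (Fin n) (Fin r) ℂ) (DΘ : Matrix (Fin r) (Fin r) ℂ),
      (∀ z : ℂ, IsUnit (1 - z • A) →
        ratEval Θ z = DΘ + z • (CΦ * (1 - z • A)⁻¹ * BΘ)) ∧
      Matrix.toEuclideanLin (BΘᴴ * obsGramian CΦ A * A + DΘᴴ * CΦ) ∘ₗ
        (spaceX C A hA Φ hΦ).subtype = 0 ∧
      BΘᴴ * obsGramian CΦ A * BΘ + DΘᴴ * DΘ = 1 := by
  -- The columns of `(Θ(z) - Θ(0)) / z` lie in `Ker T_Θ^* = ℳ_Φ`, hence in `Im W_{Φ,obs}`.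
  have hcol : ∀ j : Fin r, ∃ x : EuclideanSpace ℂ (Fin n), ∀ ν,
      (toeplitz Θ hΘ (lp.single 2 0 (EuclideanSpace.single j 1)) :
        ℕ → EuclideanSpace ℂ (Fin r)) (ν + 1) = obsOp CΦ A hA x ν := by
    intro j
    obtain ⟨h, hh⟩ := exists_backwardShift
      (toeplitz Θ hΘ (lp.single 2 0 (EuclideanSpace.single j 1)))
    have hmem : h ∈ spaceM C A hA Φ hΦ := by
      rw [← hker]
      exact adjoint_toeplitz_eq_zero_of_shift hΘ hinner hh
    obtain ⟨x, hx⟩ := exists_obsOp_eq_of_mem_spaceM hΦR.2 hCΦ hmem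
    exact ⟨x, fun ν => by rw [hh, hx]⟩
  choose x hx using hcol
  set B : Matrix (Fin n) (Fin r) ℂ := Matrix.of fun i j => x j i with hB
  set D : Matrix (Fin r) (Fin r) ℂ := taylorCoeff Θ 0 with hD
  have hBx : ∀ j, Matrix.toEuclideanLin B (EuclideanSpace.single j 1) = x j := by
    intro j
    ext i
    simp [hB, Matrix.toLpLin_apply]
  have hT0 : ∀ u : EuclideanSpace ℂ (Fin r),
      (toeplitz Θ hΘ (lp.single 2 0 u) : ℕ → EuclideanSpace ℂ (Fin r)) 0 =
        Matrix.toEuclideanLin D u := by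
    intro u
    rw [toeplitz_single_apply, if_pos le_rfl]
  refine ⟨B, D, fun z hz => ratEval_eq_of_taylorCoeff_succ hA hΘ (fun ν => ?_) hz, ?_, ?_⟩
  · ext i j
    have h1 := hx j ν
    rw [toeplitz_single_apply, if_pos (Nat.zero_le _), Nat.sub_zero, obsOp_apply, ← hBx j,
      ← toEuclideanLin_mul_apply] at h1
    rw [← inner_single_toEuclideanLin_single (taylorCoeff Θ (ν + 1)), h1,
      inner_single_toEuclideanLin_single]
  · -- `W_{Φ,obs} y ∈ Ker T_Θ^*` is orthogonal to the columns of `Θ`, for `y ∈ 𝒳_Φ`.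
    ext1 ⟨y, hy⟩
    ext j
    have hmem : obsOp CΦ A hA y ∈
        LinearMap.ker (ContinuousLinearMap.adjoint (toeplitz Θ hΘ)).toLinearMap :=
      hker ▸ obsOp_mem_spaceM hCΦ hy
    have h0 : ContinuousLinearMap.adjoint (toeplitz Θ hΘ) (obsOp CΦ A hA y) = 0 := hmem
    have h1 : inner ℂ (toeplitz Θ hΘ (lp.single 2 0 (EuclideanSpace.single j 1)))
        (obsOp CΦ A hA y) = 0 := by
      rw [← ContinuousLinearMap.adjoint_inner_right, h0, inner_zero_right]
    rw [inner_eq_inner_zero_add_inner_shift (hx j)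
      (g' := obsOp CΦ A hA (Matrix.toEuclideanLin A y)) (fun ν => by
        rw [obsOp_apply, obsOp_apply, pow_succ, ← Matrix.mul_assoc, toEuclideanLin_mul_apply]),
      hT0, obsOp_apply, pow_zero, Matrix.mul_one, inner_obsOp_obsOp, ← hBx j,
      ← inner_toEuclideanLin_conjTranspose, ← inner_toEuclideanLin_conjTranspose,
      ← toEuclideanLin_mul_apply, ← toEuclideanLin_mul_apply, ← toEuclideanLin_mul_apply,
      ← inner_add_right, ← LinearMap.add_apply, ← map_add, add_comm] at h1
    simpa [EuclideanSpace.inner_single_left] using h1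
  · -- The columns of `Θ` are orthonormal in `ℓ²`.
    ext i j
    have h1 := inner_toeplitz_single hΘ hinner 0 (EuclideanSpace.single i 1)
      (EuclideanSpace.single j 1)
    rw [inner_eq_inner_zero_add_inner_shift (hx i) (hx j), hT0, hT0, inner_obsOp_obsOp,
      ← hBx i, ← hBx j, ← inner_toEuclideanLin_conjTranspose, ← inner_toEuclideanLin_conjTranspose,
      ← toEuclideanLin_mul_apply, ← toEuclideanLin_mul_apply, ← toEuclideanLin_mul_apply,
      ← inner_add_right, ← LinearMap.add_apply, ← map_add, add_comm,
      inner_single_toEuclideanLin_single, if_pos rfl] at h1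
    rw [h1, EuclideanSpace.inner_single_left]
    simp [Matrix.one_apply]
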